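/- Let $d\ge 1$ and let $\Omega\subseteq\mathbb R^d$ be an open set composed of finitely many pairwise disjoint open subdomains $\Omega_1,\dots,\Omega_N\subseteq\Omega$, up to a Lebesgue null set. Let $\kappa$ be a real function on $\Omega$ with $\kappa=\kappa_m$ on $\Omega_m$, where each $\kappa_m$ is smooth on $\Omega_m$, and let $Q$ be bounded and measurable on $\Omega$. Let $u$ be a weak solution of $$-\nabla\cdot(\kappa\nabla u)=Q\quad\text{in }\Omega,$$ that is, $u\in L^1_{\mathrm{loc}}(\Omega)$ has a weak gradient $\nabla u\in L^1_{\mathrm{loc}}(\Omega)$ with $\kappa\nabla u\in L^1_{\mathrm{loc}}(\Omega)$, and $\int_\Omega\kappa\nabla u\cdot\nabla\varphi\,dx=\int_\Omega Q\varphi\,dx$ for all $\varphi\in C_c^\infty(\Omega)$. Fix two materials, numbered $1$ and $2$ for simplicity, and let $\Gamma$ be their interface: the set of points of $\Omega$ near which there is a $C^1$ hypersurface having exactly $\Omega_1$ on one side and exactly $\Omega_2$ on the other. Suppose that, for $m=1,2$, the function $u$ is differentiable at every point of $\Omega_m$, and that $\kappa_m$ and the classical gradient $\nabla u|_{\Omega_m}$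 are continuous up to $\Gamma$, i.e. extend continuously to $\Omega_m\cup\Gamma$. Denote by $\kappa_1,\ \nabla u|_{\Gamma^-}$ and $\kappa_2,\ \nabla u|_{\Gamma^+}$ the resulting limits on $\Gamma$ taken from $\Omega_1$ and $\Omega_2$, and let $\boldsymbol n_1,\boldsymbol n_2$ be the outer unit normals of $\Omega_1,\Omega_2$ on $\Gamma$. Then: 1. At every point of $\Gamma$, $$-\kappa_1\nabla u|_{\Gamma^-}\cdot\boldsymbol n_1=-\bigl(-\kappa_2\nabla u|_{\Gamma^+}\cdot\boldsymbol n_2\bigr).$$ 2. For every control volume $V$, i.e. every bounded Borel set with $\overline V\subseteq\Omega_1\cup\Gamma\cup\Omega_2$, both normal fluxes are integrable on $\Gamma\cap V$ with respect to the $(d-1)$-dimensional surface measure $dS$, and $$\int_{\Gamma\cap V}\bigl(-\kappa_1\nabla u|_{\Gamma^-}\bigr)\cdot\boldsymbol n_1\,dS+\int_{\Gamma\cap V}\bigl(-\kappa_2\nabla u|_{\Gamma^+}\bigr)\cdot\boldsymbol n_2\,dS=0.$$ -/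

import Mathlib

open MeasureTheory Set Topology
open scoped ContDiff Gradient

/-- `φ` is a test function on `Ω`: smooth with compact support contained in `Ω`. -/
def IsTestFunction {d : ℕ} (Ω : Set (EuclideanSpace ℝ (Fin d)))
    (φ : EuclideanSpace ℝ (Fin d) → ℝ) : Prop :=
  ContDiff ℝ ∞ φ ∧ HasCompactSupport φ ∧ tsupport φ ⊆ Ω

/-- `g` is the weak (distributional) gradient of `u` on `Ω`. -/
structure IsWeakGradient {d : ℕ} (Ω : Set (EuclideanSpace ℝ (Fin d)))
    (u : EuclideanSpace ℝ (Fin d) → ℝ)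
    (g : EuclideanSpace ℝ (Fin d) → EuclideanSpace ℝ (Fin d)) : Prop where
  locallyIntegrableOn_fun : LocallyIntegrableOn u Ω volume
  locallyIntegrableOn_grad : LocallyIntegrableOn g Ω volume
  integral_eq : ∀ φ : EuclideanSpace ℝ (Fin d) → ℝ, IsTestFunction Ω φ →
    ∫ x in Ω, u x • ∇ φ x = -∫ x in Ω, φ x • g x

/-- `u` is a weak solution of `-∇ · (κ ∇u) = Q` on `Ω`: `u` has a weak gradient `g` on `Ω`, the
flux density `κ g` is locally integrable, and `∫ κ g · ∇φ = ∫ Q φ` for all test functions `φ`. -/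
def IsWeakSolution {d : ℕ} (Ω : Set (EuclideanSpace ℝ (Fin d)))
    (κ Q u : EuclideanSpace ℝ (Fin d) → ℝ) : Prop :=
  ∃ g : EuclideanSpace ℝ (Fin d) → EuclideanSpace ℝ (Fin d),
    IsWeakGradient Ω u g ∧
    LocallyIntegrableOn (fun x => κ x • g x) Ω volume ∧
    ∀ φ : EuclideanSpace ℝ (Fin d) → ℝ, IsTestFunction Ω φ →
      ∫ x in Ω, inner ℝ (κ x • g x) (∇ φ x) = ∫ x in Ω, Q x * φ x

/-- The open set `Ω` is composed of the pairwise disjoint open subdomains `D m`, up to a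
Lebesgue null set (the material interfaces). -/
structure IsMaterialDecomposition {d N : ℕ} (Ω : Set (EuclideanSpace ℝ (Fin d)))
    (D : Fin N → Set (EuclideanSpace ℝ (Fin d))) : Prop where
  isOpen_domain : IsOpen Ω
  isOpen_sub : ∀ m, IsOpen (D m)
  sub_subset : ∀ m, D m ⊆ Ω
  pairwise_disjoint : ∀ m m', m ≠ m' → Disjoint (D m) (D m')
  null_compl : volume (Ω \ ⋃ m, D m) = 0

/-- The material interface in `Ω` between `A` and `B`: the points of `Ω` near which some
`C¹` hypersurface `{ρ = 0}` (with `∇ρ ≠ 0`) has exactly `A` on its side `{ρ < 0}` and exactly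
`B` on its side `{ρ > 0}`. -/
def materialInterface {d : ℕ} (Ω A B : Set (EuclideanSpace ℝ (Fin d))) :
    Set (EuclideanSpace ℝ (Fin d)) :=
  {x | x ∈ Ω ∧ ∃ (U : Set (EuclideanSpace ℝ (Fin d))) (ρ : EuclideanSpace ℝ (Fin d) → ℝ),
    IsOpen U ∧ x ∈ U ∧ ContDiffOn ℝ 1 ρ U ∧ ρ x = 0 ∧ ∇ ρ x ≠ 0 ∧
    ∀ y ∈ U, (y ∈ A ↔ ρ y < 0) ∧ (y ∈ B ↔ 0 < ρ y)}

/-- `n` is the outer unit normal of `A` at its `C¹` boundary point `x`: near `x`, `A` is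
`{ρ < 0}` for a `C¹` function `ρ` with `ρ x = 0`, `∇ρ x ≠ 0`, and `n = ∇ρ x / |∇ρ x|`. -/
def IsOuterUnitNormal {d : ℕ} (A : Set (EuclideanSpace ℝ (Fin d)))
    (x n : EuclideanSpace ℝ (Fin d)) : Prop :=
  ∃ (U : Set (EuclideanSpace ℝ (Fin d))) (ρ : EuclideanSpace ℝ (Fin d) → ℝ),
    IsOpen U ∧ x ∈ U ∧ ContDiffOn ℝ 1 ρ U ∧ ρ x = 0 ∧ ∇ ρ x ≠ 0 ∧
    (∀ y ∈ U, y ∈ A ↔ ρ y < 0) ∧ n = ‖∇ ρ x‖⁻¹ • ∇ ρ x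

/-- `G` is the gradient of `u` on the open set `A`, extended continuously to `A ∪ Γ`; for
`x ∈ Γ ⊆ ∂A` the value `G x` is the one-sided limit of `∇u` at `x` taken from inside `A`. -/
def IsGradientUpTo {d : ℕ} (u : EuclideanSpace ℝ (Fin d) → ℝ)
    (A Γ : Set (EuclideanSpace ℝ (Fin d)))
    (G : EuclideanSpace ℝ (Fin d) → EuclideanSpace ℝ (Fin d)) : Prop :=
  (∀ x ∈ A, HasGradientAt u (G x) x) ∧ ContinuousOn G (A ∪ Γ)

/-! The jump relation is local, so it is proved by blowing up at a point `x₀` of the interface.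
Testing the weak equation for the flux `F = κ∇u` with a bump `φ((x - x₀)/ε)` and rescaling gives `∫
F(x₀ + εy)·∇φ(y) dy = ε ∫ Q(x₀ + εy) φ(y) dy`, which tends to `0` because `Q` is bounded. On the
left, `F(x₀ + εy)` tends to the one-sided limit `a` if `n·y < 0` and to `b` if `n·y > 0`. Dominated
convergence yields `(a - b)·n ∫_{n·y<0} n·∇φ = 0`, and for a radially decreasing `φ` the last
integral is positive. Hence `a·n = b·n` (`inner_eq_of_weak_divergence_bounded`), without a
divergence theorem on curved domains.

To apply this, the weak gradient must agree a.e. with the classical one inside each material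
(`IsWeakGradient.ae_eq_gradient`), no third material may come near `x₀`, and the two outer normals
must be opposite. The integral statement then follows by integrating the pointwise one.
Integrability holds because the normal fluxes are continuous and the relevant part of the interface
lies in a compact set of finite surface measure. -/

/-! ### Unit vectors, half-spaces and gradients -/

section InnerProduct

variable {E : Type*} [NormedAddCommGroup E] [InnerProductSpace ℝ E]

/-- If `a ≠ b`, then `⟪a, b⟫ < 1`, and `y = b - a` has negative product with `a` but positive
product with `b`. -/
theorem eq_of_norm_eq_one_of_halfspace_subset {a b : E} (ha : ‖a‖ = 1) (hb : ‖b‖ = 1)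
    (h : ∀ y, inner ℝ a y < 0 → inner ℝ b y ≤ 0) : a = b := by
  by_contra hab
  have hlt : inner ℝ a b < 1 := (inner_lt_one_iff_real_of_norm_eq_one ha hb).2 hab
  have h1 := h (b - a) (by
    rw [inner_sub_right, real_inner_self_eq_norm_sq, ha]; linarith)
  rw [inner_sub_right, real_inner_self_eq_norm_sq, hb, real_inner_comm] at h1
  linarith

variable [CompleteSpace E]

theorem HasGradientAt.eventually_neg {ρ : E → ℝ} {a x y : E} (h : HasGradientAt ρ a x)
    (hx : ρ x = 0) (hy : inner ℝ a y < 0) : ∀ᶠ t : ℝ in 𝓝[>] 0, ρ (x + t • y) < 0 := by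
  have hd : HasDerivAt (fun t : ℝ => ρ (x + t • y)) (inner ℝ a y) 0 := by
    simpa [HasLineDerivAt] using h.hasFDerivAt.hasLineDerivAt y
  have ht := (hasDerivAt_iff_tendsto_slope.1 hd).eventually (gt_mem_nhds hy)
  filter_upwards [ht.filter_mono (nhdsWithin_mono 0 fun t (ht : 0 < t) => ht.ne'),
    self_mem_nhdsWithin] with t h1 h2
  have h2 : 0 < t := h2
  simp only [slope, vsub_eq_sub, sub_zero, zero_smul, add_zero, hx, smul_eq_mul] at h1
  exact neg_of_mul_neg_right h1 (inv_pos.2 h2).le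

theorem HasGradientAt.neg_fun {ρ : E → ℝ} {a x : E} (h : HasGradientAt ρ a x) :
    HasGradientAt (fun y => -ρ y) (-a) x := by
  rw [hasGradientAt_iff_hasFDerivAt, map_neg]
  exact h.hasFDerivAt.neg

theorem inner_gradient_eq_fderiv (φ : E → ℝ) (x v : E) :
    inner ℝ v (∇ φ x) = fderiv ℝ φ x v := by
  rw [real_inner_comm, ← InnerProductSpace.toDual_apply_apply, toDual_gradient]

theorem ContDiff.continuous_gradient {φ : E → ℝ} (h : ContDiff ℝ ∞ φ) : Continuous (∇ φ) :=
  (InnerProductSpace.toDual ℝ E).symm.continuous.comp (h.continuous_fderiv (by simp))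

theorem ContDiffOn.continuousOn_gradient {φ : E → ℝ} {U : Set E} (h : ContDiffOn ℝ 1 φ U)
    (hU : IsOpen U) : ContinuousOn (∇ φ) U :=
  (InnerProductSpace.toDual ℝ E).symm.continuous.comp_continuousOn
    (h.continuousOn_fderiv_of_isOpen hU le_rfl)

theorem tsupport_gradient_subset (φ : E → ℝ) : tsupport (∇ φ) ⊆ tsupport φ := by
  refine closure_minimal (fun x hx => ?_) (isClosed_tsupport _)
  refine support_fderiv_subset ℝ (f := φ) fun h => hx ?_
  simp [gradient, h]

theorem HasCompactSupport.gradient {φ : E → ℝ} (h : HasCompactSupport φ) :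
    HasCompactSupport (∇ φ) :=
  h.of_isClosed_subset (isClosed_tsupport _) (tsupport_gradient_subset φ)

end InnerProduct

/-! ### Blow-up of a weak divergence equation at a point -/

section Halfspace

variable {E : Type*} [NormedAddCommGroup E] [InnerProductSpace ℝ E] [FiniteDimensional ℝ E]
  [MeasurableSpace E] [BorelSpace E]

/-- A radial, radially decreasing bump function supported in the closed unit ball. -/
noncomputable def radialBump (x : E) : ℝ := Real.smoothTransition (1 - ‖x‖ ^ 2)

omit [FiniteDimensional ℝ E] [MeasurableSpace E] [BorelSpace E] in
theorem contDiff_radialBump : ContDiff ℝ ∞ (radialBump : E → ℝ) :=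
  Real.smoothTransition.contDiff.comp (contDiff_const.sub (contDiff_norm_sq ℝ))

omit [InnerProductSpace ℝ E] [FiniteDimensional ℝ E] [MeasurableSpace E] [BorelSpace E] in
theorem tsupport_radialBump_subset : tsupport (radialBump : E → ℝ) ⊆ Metric.closedBall 0 1 := by
  refine closure_minimal (fun x hx => ?_) Metric.isClosed_closedBall
  rw [mem_closedBall_zero_iff]
  by_contra h
  refine hx (Real.smoothTransition.zero_of_nonpos ?_)
  nlinarith

omit [MeasurableSpace E] [BorelSpace E] in
theorem hasCompactSupport_radialBump : HasCompactSupport (radialBump : E → ℝ) :=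
  (isCompact_closedBall 0 1).of_isClosed_subset (isClosed_tsupport _) tsupport_radialBump_subset

omit [MeasurableSpace E] [BorelSpace E] in
theorem inner_gradient_radialBump (v x : E) :
    inner ℝ v (∇ radialBump x) =
      -(2 * deriv Real.smoothTransition (1 - ‖x‖ ^ 2) * inner ℝ v x) := by
  have h1 : HasFDerivAt (fun y : E => 1 - ‖y‖ ^ 2) (-(2 • innerSL ℝ x)) x := by
    simpa using (hasStrictFDerivAt_norm_sq x).hasFDerivAt.const_sub 1
  have h2 : HasDerivAt Real.smoothTransition (deriv Real.smoothTransition (1 - ‖x‖ ^ 2))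
      (1 - ‖x‖ ^ 2) :=
    ((Real.smoothTransition.contDiff (n := 1)).differentiable (by simp) _).hasDerivAt
  have h3 := h2.comp_hasFDerivAt x h1
  rw [inner_gradient_eq_fderiv]
  change fderiv ℝ (Real.smoothTransition ∘ fun y : E => 1 - ‖y‖ ^ 2) x v = _
  rw [h3.fderiv]
  simp [real_inner_comm]
  ring

theorem integrable_inner_gradient {φ : E → ℝ} (h : ContDiff ℝ ∞ φ) (hc : HasCompactSupport φ)
    (v : E) : Integrable (fun x => inner ℝ v (∇ φ x)) :=
  (continuous_const.inner h.continuous_gradient).integrable_of_hasCompactSupport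
    (hc.gradient.comp_left (inner_zero_right v))

/-- The indicator of `S` is constant along `v`, so integration by parts in that direction leaves no
boundary term and no regularity of `S` is needed. -/
theorem setIntegral_inner_gradient_eq_zero_of_invariant {φ : E → ℝ} (h : ContDiff ℝ ∞ φ)
    (hc : HasCompactSupport φ) {S : Set E} (hS : MeasurableSet S) {v : E}
    (hv : ∀ (x : E) (t : ℝ), x + t • v ∈ S ↔ x ∈ S) :
    ∫ x in S, inner ℝ v (∇ φ x) = 0 := by
  have hi := integrable_inner_gradient h hc v
  have hφ : Integrable φ := h.continuous.integrable_of_hasCompactSupport hc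
  have hind : ∀ f : E → ℝ, (fun x => S.indicator (fun _ => (1 : ℝ)) x * f x) = S.indicator f := by
    intro f
    ext x
    by_cases hx : x ∈ S <;> simp [hx]
  have key := integral_bilinear_hasLineDerivAt_right_eq_neg_left_of_integrable (μ := volume)
    (f := S.indicator (fun _ => (1 : ℝ))) (f' := fun _ => 0)
    (g := φ) (g' := fun x => inner ℝ v (∇ φ x)) (v := v) (B := ContinuousLinearMap.mul ℝ ℝ)
    (by simp)
    (by simp only [ContinuousLinearMap.mul_apply', hind]; exact hi.indicator hS)
    (by simp only [ContinuousLinearMap.mul_apply', hind]; exact hφ.indicator hS)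
    (fun x _ => by
      have : (fun t : ℝ => S.indicator (fun _ => (1 : ℝ)) (x + t • v)) =
          fun _ => S.indicator (fun _ => (1 : ℝ)) x := by
        ext t
        by_cases hx : x ∈ S
        · rw [indicator_of_mem hx, indicator_of_mem ((hv x t).2 hx)]
        · rw [indicator_of_notMem hx, indicator_of_notMem (mt (hv x t).1 hx)]
      rw [HasLineDerivAt, this]
      exact hasDerivAt_const _ _)
    (fun x _ => by
      rw [inner_gradient_eq_fderiv]
      exact (h.differentiable (by simp) x).hasFDerivAt.hasLineDerivAt v)
  simp only [ContinuousLinearMap.mul_apply', hind] at key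
  rw [← integral_indicator hS, key]
  simp

/-- The integrand is nonnegative on the half-space because the bump decreases radially. A zero
integral would make it vanish there by continuity, contradicting the drop of the bump along the ray
`-t • n`. -/
theorem setIntegral_halfspace_inner_gradient_radialBump_pos {n : E} (hn : ‖n‖ = 1) :
    0 < ∫ x in {x : E | inner ℝ n x < 0}, inner ℝ n (∇ radialBump x) := by
  have ho : IsOpen {x : E | inner ℝ n x < 0} := isOpen_lt (by fun_prop) (by fun_prop)
  have hnn : ∀ x ∈ {x : E | inner ℝ n x < 0}, 0 ≤ inner ℝ n (∇ radialBump x) := by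
    intro x hx
    have hx : inner ℝ n x < 0 := hx
    have := Real.smoothTransition.monotone.deriv_nonneg (x := 1 - ‖x‖ ^ 2)
    rw [inner_gradient_radialBump]
    nlinarith
  have hcont : Continuous fun x : E => inner ℝ n (∇ radialBump x) :=
    continuous_const.inner contDiff_radialBump.continuous_gradient
  refine lt_of_le_of_ne (setIntegral_nonneg ho.measurableSet hnn) fun h0 => ?_
  have hae := (setIntegral_eq_zero_iff_of_nonneg_ae
    (ae_restrict_of_forall_mem ho.measurableSet hnn)
    (integrable_inner_gradient contDiff_radialBump hasCompactSupport_radialBump n).integrableOn).1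
    h0.symm
  have hzero := Measure.eqOn_open_of_ae_eq hae ho hcont.continuousOn continuousOn_const
  have hder : ∀ t : ℝ, HasDerivAt (fun t : ℝ => radialBump (-t • n))
      (-inner ℝ n (∇ radialBump (-t • n))) t := by
    intro t
    have h1 : HasDerivAt (fun t : ℝ => -t • n) (-n) t := by
      simpa using ((hasDerivAt_id t).neg).smul_const n
    have h2 := (contDiff_radialBump.differentiable (by simp) (-t • n)).hasFDerivAt.comp_hasDerivAt
      t h1
    rw [inner_gradient_eq_fderiv, ← map_neg]
    exact h2
  -- Mean value theorem on `[0, 1]`: the bump is `1` at the origin and `0` at `-n`.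
  obtain ⟨t, ht, hs⟩ := exists_hasDerivAt_eq_slope _ _ (zero_lt_one' ℝ)
    (fun t _ => (hder t).continuousAt.continuousWithinAt) (fun t _ => hder t)
  have := hzero (show -t • n ∈ {x : E | inner ℝ n x < 0} by
    simp [inner_smul_right, hn, ht.1])
  simp only [Pi.zero_apply] at this
  rw [this] at hs
  simp [radialBump, hn] at hs

omit [MeasurableSpace E] [BorelSpace E] in
theorem gradient_comp_inv_smul_sub {φ : E → ℝ} (h : Differentiable ℝ φ) (x₀ y : E) {ε : ℝ}
    (hε : ε ≠ 0) : ∇ (fun x => φ (ε⁻¹ • (x - x₀))) (x₀ + ε • y) = ε⁻¹ • ∇ φ y := by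
  refine ext_inner_left ℝ fun v => ?_
  have h1 : HasFDerivAt (fun x : E => ε⁻¹ • (x - x₀)) (ε⁻¹ • ContinuousLinearMap.id ℝ E)
      (x₀ + ε • y) := ((hasFDerivAt_id _).sub_const _).const_smul _
  have h2 : ε⁻¹ • ((x₀ + ε • y) - x₀) = y := by
    rw [add_sub_cancel_left, smul_smul, inv_mul_cancel₀ hε, one_smul]
  have h3 : HasFDerivAt φ (fderiv ℝ φ y) (ε⁻¹ • ((x₀ + ε • y) - x₀)) := by
    rw [h2]; exact (h y).hasFDerivAt
  rw [inner_gradient_eq_fderiv, inner_smul_right, inner_gradient_eq_fderiv]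
  exact (congrArg (fun L : E →L[ℝ] ℝ => L v) (h3.comp (x₀ + ε • y) h1).fderiv).trans (by simp)

theorem integral_comp_add_smul (f : E → ℝ) (x₀ : E) {ε : ℝ} (hε : 0 < ε) :
    ∫ y, f (x₀ + ε • y) = (ε ^ Module.finrank ℝ E)⁻¹ * ∫ x, f x := by
  rw [Measure.integral_comp_smul_of_nonneg volume (fun y => f (x₀ + y)) ε (hR := hε.le),
    integral_add_left_eq_self f x₀, smul_eq_mul]

/-- The weak identity `div F = -q`, tested with a bump function concentrated near `x₀`. -/
theorem integral_inner_gradient_radialBump_rescaled {F : E → E} {q : E → ℝ} {x₀ : E} {r : ℝ}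
    (hweak : ∀ φ : E → ℝ, ContDiff ℝ ∞ φ → HasCompactSupport φ → tsupport φ ⊆ Metric.ball x₀ r →
      ∫ x, inner ℝ (F x) (∇ φ x) = ∫ x, q x * φ x) {ε : ℝ} (hε : 0 < ε) (hεr : ε < r) :
    ∫ y, inner ℝ (F (x₀ + ε • y)) (∇ radialBump y) =
      ε * ∫ y, q (x₀ + ε • y) * radialBump y := by
  have hsm := contDiff_radialBump (E := E)
  have hψs : ContDiff ℝ ∞ (fun x : E => radialBump (ε⁻¹ • (x - x₀))) :=
    hsm.comp ((contDiff_id.sub contDiff_const).const_smul ε⁻¹)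
  have hsub : tsupport (fun x : E => radialBump (ε⁻¹ • (x - x₀))) ⊆ Metric.closedBall x₀ ε := by
    refine closure_minimal (fun x hx => ?_) Metric.isClosed_closedBall
    have hx' : ε⁻¹ • (x - x₀) ∈ Function.support (radialBump : E → ℝ) := hx
    have := tsupport_radialBump_subset (subset_tsupport _ hx')
    rw [mem_closedBall_zero_iff, norm_smul, norm_inv, Real.norm_of_nonneg hε.le,
      inv_mul_le_iff₀ hε, mul_one] at this
    rwa [mem_closedBall_iff_norm]
  have hw := hweak _ hψs
    ((isCompact_closedBall x₀ ε).of_isClosed_subset (isClosed_tsupport _) hsub)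
    (hsub.trans (Metric.closedBall_subset_ball hεr))
  -- Both integrals acquire the same Jacobian, which cancels; the surviving factor `ε` comes from
  -- the gradient of the rescaled bump.
  have e1 := integral_comp_add_smul
    (fun x => inner ℝ (F x) (∇ (fun x : E => radialBump (ε⁻¹ • (x - x₀))) x)) x₀ hε
  have e2 := integral_comp_add_smul (fun x => q x * radialBump (ε⁻¹ • (x - x₀))) x₀ hε
  simp only [gradient_comp_inv_smul_sub (hsm.differentiable (by simp)) x₀ _ hε.ne',
    inner_smul_right, integral_const_mul] at e1
  simp only [add_sub_cancel_left, smul_smul, inv_mul_cancel₀ hε.ne', one_smul] at e2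
  rw [hw, ← e2] at e1
  rw [← e1, mul_inv_cancel_left₀ hε.ne']

theorem tendsto_integral_inner_gradient_radialBump_rescaled {F : E → E} {q : E → ℝ} {x₀ : E}
    {C r : ℝ} (hq : ∀ x, |q x| ≤ C) (hr : 0 < r)
    (hweak : ∀ φ : E → ℝ, ContDiff ℝ ∞ φ → HasCompactSupport φ → tsupport φ ⊆ Metric.ball x₀ r →
      ∫ x, inner ℝ (F x) (∇ φ x) = ∫ x, q x * φ x) :
    Filter.Tendsto (fun ε : ℝ => ∫ y, inner ℝ (F (x₀ + ε • y)) (∇ radialBump y))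
      (𝓝[>] 0) (𝓝 0) := by
  have hbi : Integrable (fun x : E => |radialBump x|) :=
    (contDiff_radialBump.continuous.integrable_of_hasCompactSupport
      hasCompactSupport_radialBump).abs
  have hz : Filter.Tendsto (fun ε : ℝ => ε * (C * ∫ y : E, |radialBump y|)) (𝓝[>] 0) (𝓝 0) := by
    have : Filter.Tendsto (fun ε : ℝ => ε * (C * ∫ y : E, |radialBump y|)) (𝓝 0)
      (𝓝 (0 * (C * ∫ y : E, |radialBump y|))) := Filter.tendsto_id.mul_const _
    rw [zero_mul] at this
    exact this.mono_left nhdsWithin_le_nhds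
  refine squeeze_zero_norm' ?_ hz
  filter_upwards [Ioo_mem_nhdsGT hr] with ε hε
  rw [integral_inner_gradient_radialBump_rescaled hweak hε.1 hε.2, norm_mul,
    Real.norm_of_nonneg hε.1.le, ← integral_const_mul]
  refine mul_le_mul_of_nonneg_left ?_ hε.1.le
  refine norm_integral_le_of_norm_le (hbi.const_mul C) (.of_forall fun y => ?_)
  rw [norm_mul, Real.norm_eq_abs, Real.norm_eq_abs]
  exact mul_le_mul_of_nonneg_right (hq _) (abs_nonneg _)

theorem ae_inner_ne_zero {n : E} (hn : n ≠ 0) : ∀ᵐ y : E, inner ℝ n y ≠ 0 := by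
  have hne : (ℝ ∙ n)ᗮ ≠ ⊤ := fun h => by
    have : n ∈ (ℝ ∙ n)ᗮ := h ▸ Submodule.mem_top
    rw [Submodule.mem_orthogonal_singleton_iff_inner_right] at this
    exact hn (inner_self_eq_zero.1 this)
  have := Measure.addHaar_submodule (volume : Measure E) _ hne
  rw [ae_iff]
  convert this using 2
  ext y
  simp [Submodule.mem_orthogonal_singleton_iff_inner_right]

/-- The constant field `b` integrates to zero over the whole space. So does the part of `a - b`
tangential to the hyperplane, over the half-space, which is invariant in that direction. Only the
normal part remains. -/
theorem integral_inner_halfspace_field_gradient_radialBump {n : E} (hn : ‖n‖ = 1) (a b : E) :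
    ∫ y, inner ℝ ({x : E | inner ℝ n x < 0}.indicator (fun _ => a - b) y + b) (∇ radialBump y) =
      inner ℝ n (a - b) * ∫ y in {x : E | inner ℝ n x < 0}, inner ℝ n (∇ radialBump y) := by
  have hsm := contDiff_radialBump (E := E)
  have hcs := hasCompactSupport_radialBump (E := E)
  have hm : MeasurableSet {x : E | inner ℝ n x < 0} :=
    measurableSet_lt (by fun_prop) (by fun_prop)
  have hb0 : ∫ y : E, inner ℝ b (∇ radialBump y) = 0 := by
    rw [← setIntegral_univ]
    exact setIntegral_inner_gradient_eq_zero_of_invariant hsm hcs .univ (by simp)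
  have ht0 : ∫ y in {x : E | inner ℝ n x < 0},
      inner ℝ ((a - b) - inner ℝ n (a - b) • n) (∇ radialBump y) = 0 := by
    refine setIntegral_inner_gradient_eq_zero_of_invariant hsm hcs hm fun x t => ?_
    simp [inner_add_right, inner_smul_right, inner_sub_right, hn]
  have hi := integrable_inner_gradient hsm hcs
  have hsplit : ∀ y : E, inner ℝ ({x : E | inner ℝ n x < 0}.indicator (fun _ => a - b) y + b)
      (∇ radialBump y) = {x : E | inner ℝ n x < 0}.indicator
        (fun y => inner ℝ (a - b) (∇ radialBump y)) y + inner ℝ b (∇ radialBump y) := by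
    intro y
    by_cases hy : y ∈ {x : E | inner ℝ n x < 0}
    · rw [indicator_of_mem hy, indicator_of_mem hy, inner_add_left]
    · rw [indicator_of_notMem hy, indicator_of_notMem hy, zero_add, zero_add]
  simp_rw [hsplit]
  rw [integral_add ((hi _).indicator hm) (hi _), hb0, add_zero, integral_indicator hm]
  simp only [inner_sub_left _ (inner ℝ n (a - b) • n), real_inner_smul_left] at ht0
  rw [integral_sub (hi _).integrableOn ((hi _).integrableOn.const_mul _), integral_const_mul] at ht0
  exact sub_eq_zero.1 ht0

/-- A piecewise continuous bounded field with bounded weak divergence near `x₀` has no jump of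
its normal component at `x₀`. -/
theorem inner_eq_of_weak_divergence_bounded {F : E → E} {q : E → ℝ} {x₀ a b n : E} {C C' r : ℝ}
    (hF : Measurable F) (hFC : ∀ x, ‖F x‖ ≤ C) (hq : ∀ x, |q x| ≤ C') (hr : 0 < r)
    (hweak : ∀ φ : E → ℝ, ContDiff ℝ ∞ φ → HasCompactSupport φ → tsupport φ ⊆ Metric.ball x₀ r →
      ∫ x, inner ℝ (F x) (∇ φ x) = ∫ x, q x * φ x)
    (hn : ‖n‖ = 1)
    (ha : ∀ y, inner ℝ n y < 0 →
      Filter.Tendsto (fun ε : ℝ => F (x₀ + ε • y)) (𝓝[>] 0) (𝓝 a))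
    (hb : ∀ y, 0 < inner ℝ n y →
      Filter.Tendsto (fun ε : ℝ => F (x₀ + ε • y)) (𝓝[>] 0) (𝓝 b)) :
    inner ℝ a n = inner ℝ b n := by
  have hsm := contDiff_radialBump (E := E)
  have hgi : Integrable (fun x : E => ‖∇ radialBump x‖) :=
    (hsm.continuous_gradient.integrable_of_hasCompactSupport
      hasCompactSupport_radialBump.gradient).norm
  have hlim0 := tendsto_integral_inner_gradient_radialBump_rescaled hq hr hweak
  have hlim1 : Filter.Tendsto (fun ε : ℝ => ∫ y, inner ℝ (F (x₀ + ε • y)) (∇ radialBump y))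
      (𝓝[>] 0) (𝓝 (∫ y, inner ℝ ({x : E | inner ℝ n x < 0}.indicator (fun _ => a - b) y + b)
        (∇ radialBump y))) := by
    refine tendsto_integral_filter_of_dominated_convergence
      (fun y => C * ‖∇ radialBump y‖) ?_ ?_ (hgi.const_mul C) ?_
    · refine .of_forall fun ε => ?_
      exact ((hF.comp (by fun_prop)).inner hsm.continuous_gradient.measurable).aestronglyMeasurable
    · refine .of_forall fun ε => .of_forall fun y => ?_
      exact (norm_inner_le_norm _ _).trans (mul_le_mul_of_nonneg_right (hFC _) (norm_nonneg _))
    -- Nothing is assumed about the limit along the hyperplane `n·y = 0`, but it is a null set.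
    · filter_upwards [ae_inner_ne_zero (n := n) (by rintro rfl; simp at hn)] with y hy
      refine Filter.Tendsto.inner ?_ tendsto_const_nhds
      rcases hy.lt_or_gt with h | h
      · simpa [h] using ha y h
      · simpa [h.le.not_gt] using hb y h
  have hI := tendsto_nhds_unique hlim1 hlim0
  rw [integral_inner_halfspace_field_gradient_radialBump hn] at hI
  have h0 := (mul_eq_zero.1 hI).resolve_right
    (setIntegral_halfspace_inner_gradient_radialBump_pos hn).ne'
  rw [inner_sub_right] at h0
  rw [real_inner_comm, real_inner_comm n b]
  exact sub_eq_zero.1 h0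

end Halfspace

/-! ### Finite surface measure of regular level sets -/

section LevelSet

variable {E : Type*} [NormedAddCommGroup E] [InnerProductSpace ℝ E] [FiniteDimensional ℝ E]
  [MeasurableSpace E] [BorelSpace E]

/-- If the increments of points of a bounded set `S` stay away from the direction `n`, then `S`
has finite Hausdorff measure in codimension one. -/
theorem hausdorffMeasure_lt_top_of_abs_inner_le {S : Set E} (hS : Bornology.IsBounded S) {n : E}
    (hn : ‖n‖ = 1) (h : ∀ y ∈ S, ∀ z ∈ S, |inner ℝ n (y - z)| ≤ ‖y - z‖ / 2) :
    μH[((Module.finrank ℝ E - 1 : ℕ) : ℝ)] S < ⊤ := by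
  have hfin : Module.finrank ℝ (ℝ ∙ n)ᗮ = Module.finrank ℝ E - 1 := by
    have h1 := (ℝ ∙ n).finrank_add_finrank_orthogonal
    rw [finrank_span_singleton (by rintro rfl; simp at hn)] at h1
    omega
  let f : S → (ℝ ∙ n)ᗮ := fun y => ⟨(y : E) - inner ℝ n (y : E) • n, by
    rw [Submodule.mem_orthogonal_singleton_iff_inner_right]
    simp [inner_sub_right, inner_smul_right, hn]⟩
  have hfsub : ∀ y z : S, ((f y - f z : (ℝ ∙ n)ᗮ) : E) =
      ((y : E) - z) - inner ℝ n ((y : E) - z) • n := by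
    intro y z
    simp only [f, Submodule.coe_sub, inner_sub_right, sub_smul]
    abel
  -- The normal part of `y - z` is at most half its length, so the projection `f` onto the
  -- orthogonal complement of `n` keeps at least the other half.
  have hanti : AntilipschitzWith 2 f := by
    refine AntilipschitzWith.of_le_mul_dist fun y z => ?_
    rw [Subtype.dist_eq, dist_eq_norm, dist_eq_norm, Submodule.coe_norm, hfsub]
    have h1 := h y y.2 z z.2
    have h2 := norm_add_le (((y : E) - z) - inner ℝ n ((y : E) - z) • n)
      (inner ℝ n ((y : E) - z) • n)
    rw [sub_add_cancel, norm_smul, hn, mul_one, Real.norm_eq_abs] at h2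
    push_cast
    linarith
  have hbdd : Bornology.IsBounded (range f) := by
    obtain ⟨R, hR⟩ := hS.exists_norm_le
    refine (Metric.isBounded_closedBall (x := (0 : (ℝ ∙ n)ᗮ)) (r := R + R)).subset ?_
    rintro _ ⟨y, rfl⟩
    rw [mem_closedBall_zero_iff, Submodule.coe_norm]
    refine (norm_sub_le _ _).trans (add_le_add (hR y y.2) ?_)
    rw [norm_smul, hn, mul_one]
    refine (norm_inner_le_norm _ _).trans ?_
    rw [hn, one_mul]
    exact hR y y.2
  have h1 : μH[((Module.finrank ℝ E - 1 : ℕ) : ℝ)] (range f) < ⊤ := by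
    rw [← hfin]
    exact hbdd.measure_lt_top
  have h2 := hanti.le_hausdorffMeasure_image
    (d := ((Module.finrank ℝ E - 1 : ℕ) : ℝ)) (Nat.cast_nonneg _) univ
  rw [image_univ, ← (isometry_subtype_coe (s := S)).hausdorffMeasure_image (.inl (Nat.cast_nonneg _)),
    image_univ, Subtype.range_coe] at h2
  exact h2.trans_lt (ENNReal.mul_lt_top (by simp) h1)

/-- A regular level set of a `C¹` function has locally finite Hausdorff measure in codimension
one. -/
theorem exists_nhds_hausdorffMeasure_levelSet_lt_top {ρ : E → ℝ} {x : E} (h : ContDiffAt ℝ 1 ρ x)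
    (hx : ∇ ρ x ≠ 0) :
    ∃ W ∈ 𝓝 x, μH[((Module.finrank ℝ E - 1 : ℕ) : ℝ)] (W ∩ {y | ρ y = 0}) < ⊤ := by
  have hpos : 0 < ‖∇ ρ x‖ := norm_pos_iff.2 hx
  -- On the level set the increment of `ρ` is zero, so an error of `‖∇ρ x‖ / 2` per unit length
  -- becomes, after normalising the gradient, the factor `1/2` required above.
  obtain ⟨s, hs, hap⟩ := (h.hasStrictFDerivAt (by simp)).approximates_deriv_on_nhds
    (c := ‖∇ ρ x‖₊ / 2) (.inr (half_pos (nnnorm_pos.2 hx)))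
  refine ⟨s ∩ Metric.ball x 1, Filter.inter_mem hs (Metric.ball_mem_nhds x one_pos), ?_⟩
  refine hausdorffMeasure_lt_top_of_abs_inner_le (n := ‖∇ ρ x‖⁻¹ • ∇ ρ x)
    (Metric.isBounded_ball.subset fun y hy => hy.1.2)
    (by rw [norm_smul, norm_inv, norm_norm, inv_mul_cancel₀ hpos.ne']) ?_
  rintro y ⟨⟨hys, -⟩, hy⟩ z ⟨⟨hzs, -⟩, hz⟩
  have h1 := hap y hys z hzs
  rw [show ρ y = 0 from hy, show ρ z = 0 from hz, sub_zero, zero_sub, norm_neg, Real.norm_eq_abs,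
    ← inner_gradient_eq_fderiv, real_inner_comm] at h1
  rw [real_inner_smul_left, abs_mul, abs_of_pos (inv_pos.2 hpos), inv_mul_le_iff₀ hpos]
  push_cast at h1
  linarith

end LevelSet

/-! ### Weak and classical gradients -/

section WeakGradient

variable {E : Type*} [NormedAddCommGroup E] [InnerProductSpace ℝ E] [FiniteDimensional ℝ E]
  [MeasurableSpace E] [BorelSpace E]

theorem integral_gradient_eq_zero {h : E → ℝ} {H : E → E} (hh : ∀ x, HasGradientAt h (H x) x)
    (hH : Continuous H) (hc : HasCompactSupport h) : ∫ x, H x = 0 := by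
  have hHeq : H = ∇ h := (gradient_eq hh).symm
  have hHc : HasCompactSupport H := hHeq ▸ hc.gradient
  refine ext_inner_left ℝ fun v => ?_
  rw [← integral_inner (hH.integrable_of_hasCompactSupport hHc), inner_zero_right]
  have hcont : Continuous h :=
    continuous_iff_continuousAt.2 fun x => (hh x).differentiableAt.continuousAt
  have hHi : Integrable fun x => inner ℝ v (H x) :=
    (hH.integrable_of_hasCompactSupport hHc).const_inner v
  have key := integral_bilinear_hasLineDerivAt_right_eq_neg_left_of_integrable (μ := volume)
    (f := fun _ : E => (1 : ℝ)) (f' := fun _ => 0)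
    (g := h) (g' := fun x => inner ℝ v (H x)) (v := v) (B := ContinuousLinearMap.mul ℝ ℝ)
    (by simp) (by simpa using hHi)
    (by simpa using hcont.integrable_of_hasCompactSupport hc)
    (fun x _ => by simpa [HasLineDerivAt] using hasDerivAt_const (0 : ℝ) (1 : ℝ))
    (fun x _ => by
      have := (hh x).hasFDerivAt.hasLineDerivAt v
      rwa [InnerProductSpace.toDual_apply_apply, real_inner_comm] at this)
  simpa using key

theorem MeasureTheory.LocallyIntegrableOn.integrable_smul_of_hasCompactSupport {f : E → E} {A : Set E}
    (hf : LocallyIntegrableOn f A volume) {φ : E → ℝ} (hφ : Continuous φ)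
    (hc : HasCompactSupport φ) (hs : tsupport φ ⊆ A) : Integrable fun x => φ x • f x := by
  have h1 : IntegrableOn (fun x => φ x • f x) (tsupport φ) :=
    (hf.integrableOn_compact_subset hs hc).continuousOn_smul hφ.continuousOn hc
  exact (integrableOn_iff_integrable_of_support_subset fun x hx =>
    subset_tsupport φ fun h0 => hx (by simp [h0])).1 h1

end WeakGradient

/-- For a test function `φ` on `A`, the product `u φ` is `C¹` with compact support, so its gradient
integrates to zero. Comparison with the weak identity gives `∫ φ (g - G) = 0`, and the fundamental
lemma of the calculus of variations concludes. -/
theorem IsWeakGradient.ae_eq_gradient {d : ℕ} {Ω A : Set (EuclideanSpace ℝ (Fin d))}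
    {u : EuclideanSpace ℝ (Fin d) → ℝ}
    {g G : EuclideanSpace ℝ (Fin d) → EuclideanSpace ℝ (Fin d)} (hg : IsWeakGradient Ω u g)
    (hA : IsOpen A) (hAΩ : A ⊆ Ω) (hG : ∀ x ∈ A, HasGradientAt u (G x) x)
    (hGc : ContinuousOn G A) : ∀ᵐ x, x ∈ A → g x = G x := by
  have hgA : LocallyIntegrableOn g A volume := hg.locallyIntegrableOn_grad.mono_set hAΩ
  have hGA : LocallyIntegrableOn G A volume := hGc.locallyIntegrableOn hA.measurableSet
  suffices H : ∀ᵐ x, x ∈ A → (g - G) x = 0 by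
    filter_upwards [H] with x hx hxA using sub_eq_zero.1 (hx hxA)
  refine hA.ae_eq_zero_of_integral_contDiff_smul_eq_zero (hgA.sub hGA) fun φ hφ hc hs => ?_
  have hig := hgA.integrable_smul_of_hasCompactSupport hφ.continuous hc hs
  have hiG := hGA.integrable_smul_of_hasCompactSupport hφ.continuous hc hs
  have hout : ∀ x, x ∉ tsupport φ → φ x = 0 ∧ ∇ φ x = 0 := fun x hx =>
    ⟨image_eq_zero_of_notMem_tsupport hx,
      image_eq_zero_of_notMem_tsupport fun h => hx (tsupport_gradient_subset φ h)⟩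
  have hweak := hg.integral_eq φ ⟨hφ, hc, hs.trans hAΩ⟩
  rw [setIntegral_eq_integral_of_forall_compl_eq_zero fun x hx => by
      rw [(hout x fun h => hx (hAΩ (hs h))).2, smul_zero],
    setIntegral_eq_integral_of_forall_compl_eq_zero fun x hx => by
      rw [(hout x fun h => hx (hAΩ (hs h))).1, zero_smul]] at hweak
  have huc : ContinuousOn u A := fun x hx => (hG x hx).differentiableAt.continuousAt.continuousWithinAt
  have hsub : tsupport (fun x => u x • ∇ φ x) ⊆ tsupport φ :=
    closure_minimal (fun x hx => by
      by_contra h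
      exact hx (by simp only [(hout x h).2, smul_zero])) (isClosed_tsupport _)
  -- Continuity is checked only on the support, since `u` need not be continuous outside `A`.
  have hcu : Continuous fun x => u x • ∇ φ x := continuous_of_tsupport fun x hx =>
    (huc.continuousAt (hA.mem_nhds (hs (hsub hx)))).smul hφ.continuous_gradient.continuousAt
  have hsub' : tsupport (fun x => φ x • G x) ⊆ tsupport φ :=
    closure_minimal (fun x hx => by
      by_contra h
      exact hx (by simp only [(hout x h).1, zero_smul])) (isClosed_tsupport _)
  have hcG : Continuous fun x => φ x • G x := continuous_of_tsupport fun x hx =>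
    hφ.continuous.continuousAt.smul (hGc.continuousAt (hA.mem_nhds (hs (hsub' hx))))
  have hiu : Integrable fun x => u x • ∇ φ x :=
    hcu.integrable_of_hasCompactSupport (hc.of_isClosed_subset (isClosed_tsupport _) hsub)
  have hprod : ∀ x, HasGradientAt (fun x => u x * φ x) (u x • ∇ φ x + φ x • G x) x := by
    intro x
    by_cases hx : x ∈ tsupport φ
    · rw [hasGradientAt_iff_hasFDerivAt, map_add, map_smul, map_smul]
      exact (hG x (hs hx)).hasFDerivAt.mul
        (hφ.differentiable (by simp) x).hasGradientAt.hasFDerivAt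
    · rw [(hout x hx).1, (hout x hx).2, smul_zero, zero_smul, add_zero,
        hasGradientAt_iff_hasFDerivAt, map_zero]
      refine (hasFDerivAt_const (0 : ℝ) x).congr_of_eventuallyEq ?_
      filter_upwards [(isClosed_tsupport φ).isOpen_compl.mem_nhds hx] with y hy
      rw [(hout y hy).1, mul_zero]
  have hzero := integral_gradient_eq_zero hprod (hcu.add hcG) hc.mul_left
  rw [integral_add hiu hiG, hweak] at hzero
  simp only [Pi.sub_apply, smul_sub]
  rw [integral_sub hig hiG, ← neg_eq_zero, neg_sub, sub_eq_neg_add]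
  exact hzero

/-! ### Normals and surface measure of the interface -/

section Interface

variable {d : ℕ} {Ω A B : Set (EuclideanSpace ℝ (Fin d))} {x : EuclideanSpace ℝ (Fin d)}

theorem IsOuterUnitNormal.norm_eq_one {n : EuclideanSpace ℝ (Fin d)}
    (h : IsOuterUnitNormal A x n) : ‖n‖ = 1 := by
  obtain ⟨U, ρ, -, -, -, -, h0, -, rfl⟩ := h
  rw [norm_smul, norm_inv, norm_norm, inv_mul_cancel₀ (norm_ne_zero_iff.2 h0)]

theorem IsOuterUnitNormal.eventually_mem {n y : EuclideanSpace ℝ (Fin d)}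
    (h : IsOuterUnitNormal A x n) (hy : inner ℝ n y < 0) :
    ∀ᶠ t : ℝ in 𝓝[>] 0, x + t • y ∈ A := by
  obtain ⟨U, ρ, hU, hxU, hρ, hx, h0, hA, rfl⟩ := h
  have hd : HasGradientAt ρ (∇ ρ x) x :=
    ((hρ.contDiffAt (hU.mem_nhds hxU)).differentiableAt (by simp)).hasGradientAt
  have hlim : Filter.Tendsto (fun t : ℝ => x + t • y) (𝓝[>] 0) (𝓝 x) := by
    have : Continuous fun t : ℝ => x + t • y := by fun_prop
    simpa using (this.tendsto 0).mono_left nhdsWithin_le_nhds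
  rw [real_inner_smul_left] at hy
  filter_upwards [hd.eventually_neg hx (neg_of_mul_neg_right hy (by positivity)),
    hlim.eventually (hU.mem_nhds hxU)] with t h1 h2 using (hA _ h2).2 h1

theorem IsOuterUnitNormal.inner_nonpos_of_eventually_mem {n y : EuclideanSpace ℝ (Fin d)}
    (h : IsOuterUnitNormal A x n) (hy : ∀ᶠ t : ℝ in 𝓝[>] 0, x + t • y ∈ A) :
    inner ℝ n y ≤ 0 := by
  obtain ⟨U, ρ, hU, hxU, hρ, hx, h0, hA, rfl⟩ := h
  have hd : HasGradientAt ρ (∇ ρ x) x :=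
    ((hρ.contDiffAt (hU.mem_nhds hxU)).differentiableAt (by simp)).hasGradientAt
  have hlim : Filter.Tendsto (fun t : ℝ => x + t • y) (𝓝[>] 0) (𝓝 x) := by
    have : Continuous fun t : ℝ => x + t • y := by fun_prop
    simpa using (this.tendsto 0).mono_left nhdsWithin_le_nhds
  rw [real_inner_smul_left]
  by_contra hpos
  have hpos : inner ℝ (-∇ ρ x) y < 0 := by
    rw [inner_neg_left, neg_lt_zero]
    exact pos_of_mul_pos_right (not_le.1 hpos) (by positivity)
  obtain ⟨t, h1, h2, h3⟩ := ((hd.neg_fun.eventually_neg (by simp [hx]) hpos).and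
    (hy.and (hlim.eventually (hU.mem_nhds hxU)))).exists
  linarith [(hA _ h3).1 h2]

/-- Directions in the open half-space of `n` enter `A`, and directions entering `A` lie in the
closed half-space of `n'`. Thus the normal does not depend on the defining function. -/
theorem IsOuterUnitNormal.unique {n n' : EuclideanSpace ℝ (Fin d)}
    (h : IsOuterUnitNormal A x n) (h' : IsOuterUnitNormal A x n') : n = n' :=
  eq_of_norm_eq_one_of_halfspace_subset h.norm_eq_one h'.norm_eq_one fun _ hy =>
    h'.inner_nonpos_of_eventually_mem (h.eventually_mem hy)

/-- Near a point of the interface a single regular function describes both materials and the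
normals at all nearby interface points. -/
theorem exists_regular_of_mem_materialInterface (hΩ : IsOpen Ω)
    (hx : x ∈ materialInterface Ω A B) :
    ∃ (U : Set (EuclideanSpace ℝ (Fin d))) (ρ : EuclideanSpace ℝ (Fin d) → ℝ),
      IsOpen U ∧ x ∈ U ∧ U ⊆ Ω ∧ ContDiffOn ℝ 1 ρ U ∧ (∀ y ∈ U, ∇ ρ y ≠ 0) ∧
      ∀ y ∈ U, (y ∈ A ↔ ρ y < 0) ∧ (y ∈ B ↔ 0 < ρ y) := by
  obtain ⟨hxΩ, U, ρ, hU, hxU, hρ, -, h0, hAB⟩ := hx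
  have hopen : IsOpen (U ∩ ∇ ρ ⁻¹' {0}ᶜ) :=
    (hρ.continuousOn_gradient hU).isOpen_inter_preimage hU isOpen_compl_singleton
  exact ⟨(U ∩ ∇ ρ ⁻¹' {0}ᶜ) ∩ Ω, ρ, hopen.inter hΩ, ⟨⟨hxU, h0⟩, hxΩ⟩, inter_subset_right,
    hρ.mono fun y hy => hy.1.1, fun y hy => hy.1.2, fun y hy => hAB y hy.1.1⟩

theorem notMem_of_mem_materialInterface (hx : x ∈ materialInterface Ω A B) : x ∉ A ∧ x ∉ B := by
  obtain ⟨-, U, ρ, -, hxU, -, h0, -, hAB⟩ := hx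
  exact ⟨fun h => ((hAB x hxU).1.1 h).ne h0, fun h => ((hAB x hxU).2.1 h).ne' h0⟩

theorem isOuterUnitNormal_of_regular {U : Set (EuclideanSpace ℝ (Fin d))}
    {ρ : EuclideanSpace ℝ (Fin d) → ℝ} (hU : IsOpen U) (hρ : ContDiffOn ℝ 1 ρ U)
    (h0 : ∀ y ∈ U, ∇ ρ y ≠ 0) (hA : ∀ y ∈ U, y ∈ A ↔ ρ y < 0) (hxU : x ∈ U) (hx : ρ x = 0) :
    IsOuterUnitNormal A x (‖∇ ρ x‖⁻¹ • ∇ ρ x) :=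
  ⟨U, ρ, hU, hxU, hρ, hx, h0 x hxU, hA, rfl⟩

theorem eq_zero_of_mem_materialInterface {U : Set (EuclideanSpace ℝ (Fin d))}
    {ρ : EuclideanSpace ℝ (Fin d) → ℝ}
    (hAB : ∀ y ∈ U, (y ∈ A ↔ ρ y < 0) ∧ (y ∈ B ↔ 0 < ρ y)) (hxU : x ∈ U)
    (hx : x ∈ materialInterface Ω A B) : ρ x = 0 := by
  have h := notMem_of_mem_materialInterface hx
  exact le_antisymm (not_lt.1 fun h' => h.2 ((hAB x hxU).2.2 h'))
    (not_lt.1 fun h' => h.1 ((hAB x hxU).1.2 h'))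

/-- If `ρ` defines `A` near `x`, then `-ρ` defines `B`; uniqueness of normals does the rest. -/
theorem IsOuterUnitNormal.neg_of_mem_materialInterface {n n' : EuclideanSpace ℝ (Fin d)}
    (hx : x ∈ materialInterface Ω A B) (h : IsOuterUnitNormal A x n)
    (h' : IsOuterUnitNormal B x n') : n' = -n := by
  obtain ⟨-, U, ρ, hU, hxU, hρ, h0, hne, hAB⟩ := hx
  have hd := ((hρ.contDiffAt (hU.mem_nhds hxU)).differentiableAt (by simp)).hasGradientAt
  have hn : IsOuterUnitNormal A x (‖∇ ρ x‖⁻¹ • ∇ ρ x) :=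
    ⟨U, ρ, hU, hxU, hρ, h0, hne, fun y hy => (hAB y hy).1, rfl⟩
  have hn' : IsOuterUnitNormal B x (-(‖∇ ρ x‖⁻¹ • ∇ ρ x)) := by
    refine ⟨U, fun y => -ρ y, hU, hxU, hρ.neg, by simp [h0], ?_, fun y hy => ?_, ?_⟩
    · rw [hd.neg_fun.gradient]
      exact neg_ne_zero.2 hne
    · rw [(hAB y hy).2, neg_lt_zero]
    · rw [hd.neg_fun.gradient, norm_neg, smul_neg]
  rw [h.unique hn, h'.unique hn']

/-- By uniqueness, a pointwise choice of normals must agree locally with the continuous field `∇ρ /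
‖∇ρ‖` of a single `ρ`. -/
theorem continuousOn_outerUnitNormal (hΩ : IsOpen Ω)
    {n : EuclideanSpace ℝ (Fin d) → EuclideanSpace ℝ (Fin d)}
    (hn : ∀ y ∈ materialInterface Ω A B, IsOuterUnitNormal A y (n y)) :
    ContinuousOn n (materialInterface Ω A B) := by
  intro x hx
  obtain ⟨U, ρ, hU, hxU, -, hρ, h0, hAB⟩ := exists_regular_of_mem_materialInterface hΩ hx
  have hg := hρ.continuousOn_gradient hU
  have hc : ContinuousAt (fun y => ‖∇ ρ y‖⁻¹ • ∇ ρ y) x :=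
    ((hg.norm.inv₀ fun y hy => norm_ne_zero_iff.2 (h0 y hy)).smul hg).continuousAt
      (hU.mem_nhds hxU)
  have heq : ∀ y ∈ materialInterface Ω A B, y ∈ U → n y = ‖∇ ρ y‖⁻¹ • ∇ ρ y := fun y hy hyU =>
    (hn y hy).unique (isOuterUnitNormal_of_regular hU hρ h0 (fun z hz => (hAB z hz).1) hyU
      (eq_zero_of_mem_materialInterface hAB hyU hy))
  refine hc.continuousWithinAt.congr_of_eventuallyEq ?_ (heq x hx hxU)
  filter_upwards [self_mem_nhdsWithin, mem_nhdsWithin_of_mem_nhds (hU.mem_nhds hxU)] with y h1 h2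
    using heq y h1 h2

theorem exists_nhds_hausdorffMeasure_materialInterface_lt_top (hΩ : IsOpen Ω)
    (hx : x ∈ materialInterface Ω A B) :
    ∃ W ∈ 𝓝 x, Measure.euclideanHausdorffMeasure (d - 1) (W ∩ materialInterface Ω A B) < ⊤ := by
  obtain ⟨U, ρ, hU, hxU, -, hρ, h0, hAB⟩ := exists_regular_of_mem_materialInterface hΩ hx
  obtain ⟨W, hW, hlt⟩ := exists_nhds_hausdorffMeasure_levelSet_lt_top
    (hρ.contDiffAt (hU.mem_nhds hxU)) (h0 x hxU)
  refine ⟨W ∩ U, Filter.inter_mem hW (hU.mem_nhds hxU), ?_⟩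
  rw [finrank_euclideanSpace_fin] at hlt
  rw [Measure.euclideanHausdorffMeasure_def, Measure.smul_apply, ENNReal.smul_def, smul_eq_mul]
  refine ENNReal.mul_lt_top ENNReal.coe_lt_top ((measure_mono fun y hy => ?_).trans_lt hlt)
  exact ⟨hy.1.1, eq_zero_of_mem_materialInterface hAB hy.1.2 hy.2⟩

/-- Continuous fields on the interface have integrable normal components on the part of the
interface in a control volume. -/
theorem integrableOn_inner_outerUnitNormal (hΩ : IsOpen Ω) (hA : IsOpen A) (hB : IsOpen B)
    {n F : EuclideanSpace ℝ (Fin d) → EuclideanSpace ℝ (Fin d)}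
    (hn : ContinuousOn n (materialInterface Ω A B))
    (hF : ContinuousOn F (materialInterface Ω A B)) {V : Set (EuclideanSpace ℝ (Fin d))}
    (hV : MeasurableSet V) (hVc : IsCompact (closure V))
    (hVs : closure V ⊆ A ∪ materialInterface Ω A B ∪ B) :
    MeasurableSet (materialInterface Ω A B ∩ V) ∧
    IntegrableOn (fun x => inner ℝ (F x) (n x)) (materialInterface Ω A B ∩ V)
      (Measure.euclideanHausdorffMeasure (d - 1)) := by
  -- Within `closure V` the interface is the complement of an open set. This makes its part in `V`
  -- Borel and its part in `closure V` compact.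
  have hinter : ∀ S ⊆ closure V, materialInterface Ω A B ∩ S = S \ (A ∪ B) := by
    intro S hS
    ext y
    refine ⟨fun hy => ⟨hy.2, fun h => ?_⟩, fun hy => ⟨?_, hy.1⟩⟩
    · exact h.elim (notMem_of_mem_materialInterface hy.1).1 (notMem_of_mem_materialInterface hy.1).2
    · rcases hVs (hS hy.1) with (h | h) | h
      · exact (hy.2 (.inl h)).elim
      · exact h
      · exact (hy.2 (.inr h)).elim
  have hm : MeasurableSet (materialInterface Ω A B ∩ V) := by
    rw [hinter V subset_closure]
    exact hV.diff (hA.union hB).measurableSet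
  have hK : IsCompact (materialInterface Ω A B ∩ closure V) := by
    rw [hinter _ Subset.rfl]
    exact hVc.diff (hA.union hB)
  have hlt : Measure.euclideanHausdorffMeasure (d - 1) (materialInterface Ω A B ∩ closure V) < ⊤ := by
    refine hK.measure_lt_top_of_nhdsWithin fun y hy => ?_
    obtain ⟨W, hW, hWlt⟩ := exists_nhds_hausdorffMeasure_materialInterface_lt_top hΩ hy.1
    exact ⟨W ∩ (materialInterface Ω A B ∩ closure V), Filter.inter_mem (mem_nhdsWithin_of_mem_nhds hW) self_mem_nhdsWithin,
      (measure_mono (by gcongr; exact inter_subset_left)).trans_lt hWlt⟩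
  have hcont : ContinuousOn (fun x => inner ℝ (F x) (n x)) (materialInterface Ω A B ∩ closure V) :=
    (hF.inner hn).mono inter_subset_left
  obtain ⟨C, hC⟩ := hK.exists_bound_of_continuousOn hcont
  have hsub : materialInterface Ω A B ∩ V ⊆ materialInterface Ω A B ∩ closure V :=
    inter_subset_inter_right _ subset_closure
  refine ⟨hm, IntegrableOn.of_bound ((measure_mono hsub).trans_lt hlt)
    ((hcont.mono hsub).aestronglyMeasurable hm) C ?_⟩
  exact ae_restrict_of_forall_mem hm fun y hy => hC y (hsub hy)

end Interface

/-! ### Continuity of the normal flux -/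

theorem ContinuousOn.measurable_indicator {X Y : Type*} [TopologicalSpace X] [MeasurableSpace X]
    [BorelSpace X] [TopologicalSpace Y] [MeasurableSpace Y] [BorelSpace Y] [Zero Y] {f : X → Y}
    {s : Set X} (hf : ContinuousOn f s) (hs : MeasurableSet s) : Measurable (s.indicator f) := by
  classical
  rw [← piecewise_eq_indicator]
  exact hf.measurable_piecewise continuousOn_const hs

/-- The normal component of the flux of a weak solution does not jump at a point of the interface
of two materials. -/
theorem IsWeakSolution.inner_normal_eq {d N : ℕ} {Ω : Set (EuclideanSpace ℝ (Fin d))}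
    {D : Fin N → Set (EuclideanSpace ℝ (Fin d))} (hD : IsMaterialDecomposition Ω D)
    {κ : EuclideanSpace ℝ (Fin d) → ℝ} {κs : Fin N → EuclideanSpace ℝ (Fin d) → ℝ}
    (hκ : ∀ m, ∀ x ∈ D m, κ x = κs m x) {Q : EuclideanSpace ℝ (Fin d) → ℝ}
    (hQ : ∃ C : ℝ, ∀ x ∈ Ω, |Q x| ≤ C) {u : EuclideanSpace ℝ (Fin d) → ℝ}
    (hu : IsWeakSolution Ω κ Q u) {i j : Fin N}
    (hκi : ContinuousOn (κs i) (D i ∪ materialInterface Ω (D i) (D j)))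
    (hκj : ContinuousOn (κs j) (D j ∪ materialInterface Ω (D i) (D j)))
    {G₁ G₂ : EuclideanSpace ℝ (Fin d) → EuclideanSpace ℝ (Fin d)}
    (hG₁ : IsGradientUpTo u (D i) (materialInterface Ω (D i) (D j)) G₁)
    (hG₂ : IsGradientUpTo u (D j) (materialInterface Ω (D i) (D j)) G₂)
    {x n : EuclideanSpace ℝ (Fin d)} (hx : x ∈ materialInterface Ω (D i) (D j))
    (hn : IsOuterUnitNormal (D i) x n) (hn' : IsOuterUnitNormal (D j) x (-n)) :
    inner ℝ (κs i x • G₁ x) n = inner ℝ (κs j x • G₂ x) n := by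
  obtain ⟨g, hg, -, hweak⟩ := hu
  obtain ⟨C', hC'⟩ := hQ
  obtain ⟨U, ρ, hU, hxU, hUΩ, hρ, h0, hAB⟩ :=
    exists_regular_of_mem_materialInterface hD.isOpen_domain hx
  have hg₁ := hg.ae_eq_gradient (hD.isOpen_sub i) (hD.sub_subset i) hG₁.1
    (hG₁.2.mono subset_union_left)
  have hg₂ := hg.ae_eq_gradient (hD.isOpen_sub j) (hD.sub_subset j) hG₂.1
    (hG₂.2.mono subset_union_left)
  have hF₁ := hκi.smul hG₁.2
  have hF₂ := hκj.smul hG₂.2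
  -- a ball on which both fluxes are bounded
  have hbd : ∀ {S : Set (EuclideanSpace ℝ (Fin d))}
      {F : EuclideanSpace ℝ (Fin d) → EuclideanSpace ℝ (Fin d)}, ContinuousWithinAt F S x →
      ∃ r > 0, ∀ y ∈ Metric.ball x r ∩ S, ‖F y‖ ≤ ‖F x‖ + 1 := fun hF =>
    Metric.mem_nhdsWithin_iff.1 (hF.norm.eventually (Iic_mem_nhds (lt_add_one _)))
  obtain ⟨r₁, hr₁, hb₁⟩ := hbd (hF₁ x (.inr hx))
  obtain ⟨r₂, hr₂, hb₂⟩ := hbd (hF₂ x (.inr hx))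
  obtain ⟨r₃, hr₃, hball⟩ := Metric.isOpen_iff.1 hU x hxU
  set r := min r₁ (min r₂ r₃) with hr
  have hrpos : 0 < r := lt_min hr₁ (lt_min hr₂ hr₃)
  have hs₁ : Metric.ball x r ⊆ Metric.ball x r₁ := Metric.ball_subset_ball (min_le_left _ _)
  have hs₂ : Metric.ball x r ⊆ Metric.ball x r₂ :=
    Metric.ball_subset_ball ((min_le_right _ _).trans (min_le_left _ _))
  have hs₃ : Metric.ball x r ⊆ U :=
    (Metric.ball_subset_ball ((min_le_right _ _).trans (min_le_right _ _))).trans hball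
  have ho₁ : IsOpen (D i ∩ Metric.ball x r) := (hD.isOpen_sub i).inter Metric.isOpen_ball
  have ho₂ : IsOpen (D j ∩ Metric.ball x r) := (hD.isOpen_sub j).inter Metric.isOpen_ball
  -- Truncating the flux to the ball makes it globally bounded and measurable; test functions
  -- supported in the ball do not see the change.
  set F : EuclideanSpace ℝ (Fin d) → EuclideanSpace ℝ (Fin d) := fun y =>
    (D i ∩ Metric.ball x r).indicator (fun y => κs i y • G₁ y) y +
      (D j ∩ Metric.ball x r).indicator (fun y => κs j y • G₂ y) y with hFdef
  have hFm : Measurable F :=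
    ((hF₁.mono fun y hy => .inl hy.1).measurable_indicator ho₁.measurableSet).add
      ((hF₂.mono fun y hy => .inl hy.1).measurable_indicator ho₂.measurableSet)
  -- The signs of `ρ` give disjointness without assuming `i ≠ j`.
  have hdisj : ∀ y ∈ Metric.ball x r, y ∈ D i → y ∉ D j := fun y hy h h' =>
    ((hAB y (hs₃ hy)).1.1 h).not_gt ((hAB y (hs₃ hy)).2.1 h')
  have hFi : ∀ y ∈ Metric.ball x r, y ∈ D i → F y = κs i y • G₁ y := fun y hy h => by
    rw [hFdef]
    simp only
    rw [indicator_of_mem (mem_inter h hy),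
      indicator_of_notMem (fun h' => hdisj y hy h (mem_of_mem_inter_left h')), add_zero]
  have hFj : ∀ y ∈ Metric.ball x r, y ∈ D j → F y = κs j y • G₂ y := fun y hy h => by
    rw [hFdef]
    simp only
    rw [indicator_of_notMem (fun h' => hdisj y hy (mem_of_mem_inter_left h') h),
      indicator_of_mem (mem_inter h hy), zero_add]
  have hFC : ∀ y, ‖F y‖ ≤ (‖κs i x • G₁ x‖ + 1) + (‖κs j x • G₂ x‖ + 1) := by
    intro y
    refine norm_add_le_of_le ?_ ?_
    · by_cases hy : y ∈ D i ∩ Metric.ball x r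
      · rw [indicator_of_mem hy]
        exact hb₁ y ⟨hs₁ hy.2, .inl hy.1⟩
      · rw [indicator_of_notMem hy, norm_zero]
        positivity
    · by_cases hy : y ∈ D j ∩ Metric.ball x r
      · rw [indicator_of_mem hy]
        exact hb₂ y ⟨hs₂ hy.2, .inl hy.1⟩
      · rw [indicator_of_notMem hy, norm_zero]
        positivity
  -- no other material meets the ball
  have hother : ∀ y ∈ Metric.ball x r, ∀ m, y ∈ D m → y ∈ D i ∨ y ∈ D j := by
    intro y hy m hm
    by_contra hcon
    obtain ⟨hi, hj⟩ := not_or.1 hcon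
    have hmi : m ≠ i := fun h => hi (h ▸ hm)
    have hmj : m ≠ j := fun h => hj (h ▸ hm)
    refine h0 y (hs₃ hy) ?_
    -- A third material is open and misses both sides, so `ρ` would vanish near `y`, against `∇ρ y ≠
    -- 0`.
    have hev : ρ =ᶠ[𝓝 y] fun _ => 0 := by
      filter_upwards [(hD.isOpen_sub m).mem_nhds hm, hU.mem_nhds (hs₃ hy)] with z hz hzU
      exact le_antisymm
        (not_lt.1 fun h => (hD.pairwise_disjoint m j hmj).notMem_of_mem_left hz
          ((hAB z hzU).2.2 h))
        (not_lt.1 fun h => (hD.pairwise_disjoint m i hmi).notMem_of_mem_left hz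
          ((hAB z hzU).1.2 h))
    rw [gradient, hev.fderiv_eq]
    simp
  have hcov : ∀ᵐ y, y ∈ Metric.ball x r → y ∈ D i ∨ y ∈ D j := by
    filter_upwards [measure_eq_zero_iff_ae_notMem.1 hD.null_compl] with y hy hyb
    have : y ∈ ⋃ m, D m := by
      by_contra h
      exact hy ⟨hUΩ (hs₃ hyb), h⟩
    obtain ⟨m, hm⟩ := mem_iUnion.1 this
    exact hother y hyb m hm
  have hlim : ∀ y : EuclideanSpace ℝ (Fin d),
      Filter.Tendsto (fun ε : ℝ => x + ε • y) (𝓝[>] 0) (𝓝 x) := fun y => by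
    have : Continuous fun t : ℝ => x + t • y := by fun_prop
    simpa using (this.tendsto 0).mono_left nhdsWithin_le_nhds
  -- The bound on `Q` holds only on `Ω`, so the source is extended by zero.
  refine inner_eq_of_weak_divergence_bounded (x₀ := x) (r := r) (q := Ω.indicator Q) (C' := max C' 0) hFm hFC
    (fun y => ?_) hrpos (fun φ hφ hc hs => ?_) hn.norm_eq_one (fun y hy => ?_) fun y hy => ?_
  · by_cases hy : y ∈ Ω
    · rw [indicator_of_mem hy]
      exact (hC' y hy).trans (le_max_left _ _)
    · rw [indicator_of_notMem hy, abs_zero]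
      exact le_max_right _ _
  · have hw := hweak φ ⟨hφ, hc, hs.trans (hs₃.trans hUΩ)⟩
    rw [← integral_indicator hD.isOpen_domain.measurableSet,
      ← integral_indicator hD.isOpen_domain.measurableSet] at hw
    have e2 : ∀ y, Ω.indicator (fun y => Q y * φ y) y = Ω.indicator Q y * φ y :=
      fun y => indicator_mul_left _ _ _
    simp only [e2] at hw
    rw [← hw]
    refine integral_congr_ae ?_
    filter_upwards [hcov, hg₁, hg₂] with y hy h1 h2
    by_cases hyb : y ∈ Metric.ball x r
    · rw [indicator_of_mem (hUΩ (hs₃ hyb))]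
      rcases hy hyb with h | h
      · rw [hFi y hyb h, hκ i y h, h1 h]
      · rw [hFj y hyb h, hκ j y h, h2 h]
    · have hz : ∇ φ y = 0 := image_eq_zero_of_notMem_tsupport fun h =>
        hyb (hs (tsupport_gradient_subset φ h))
      rw [hz, inner_zero_right]
      by_cases hyΩ : y ∈ Ω
      · rw [indicator_of_mem hyΩ, hz, inner_zero_right]
      · rw [indicator_of_notMem hyΩ]
  · have hmem := hn.eventually_mem hy
    have hT := Filter.Tendsto.comp (hF₁ x (.inr hx)) (tendsto_nhdsWithin_iff.2
      ⟨hlim y, hmem.mono fun t ht => .inl ht⟩)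
    refine hT.congr' ?_
    filter_upwards [hmem, (hlim y).eventually (Metric.ball_mem_nhds x hrpos)] with t h1 h2
    exact (hFi _ h2 h1).symm
  · have hmem := hn'.eventually_mem (y := y) (by rwa [inner_neg_left, neg_lt_zero])
    have hT := Filter.Tendsto.comp (hF₂ x (.inr hx)) (tendsto_nhdsWithin_iff.2
      ⟨hlim y, hmem.mono fun t ht => .inl ht⟩)
    refine hT.congr' ?_
    filter_upwards [hmem, (hlim y).eventually (Metric.ball_mem_nhds x hrpos)] with t h1 h2
    exact (hFj _ h2 h1).symm

theorem mainTheorem2 {d N : ℕ} (hd : 1 ≤ d)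
    (Ω : Set (EuclideanSpace ℝ (Fin d))) (D : Fin N → Set (EuclideanSpace ℝ (Fin d)))
    (hD : IsMaterialDecomposition Ω D)
    -- the coefficient: `κ = κs m` on `D m`, each `κs m` smooth there
    (κ : EuclideanSpace ℝ (Fin d) → ℝ) (κs : Fin N → EuclideanSpace ℝ (Fin d) → ℝ)
    (hκ : ∀ m, ∀ x ∈ D m, κ x = κs m x)
    (hκs : ∀ m, ContDiffOn ℝ ∞ (κs m) (D m))
    -- the bounded source
    (Q : EuclideanSpace ℝ (Fin d) → ℝ)
    (hQm : AEStronglyMeasurable Q (volume.restrict Ω))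
    (hQ : ∃ C : ℝ, ∀ x ∈ Ω, |Q x| ≤ C)
    (u : EuclideanSpace ℝ (Fin d) → ℝ) (hu : IsWeakSolution Ω κ Q u)
    -- two materials; the coefficient and `∇u` have one-sided limits at their interface
    (i j : Fin N)
    (hκi : ContinuousOn (κs i) (D i ∪ materialInterface Ω (D i) (D j)))
    (hκj : ContinuousOn (κs j) (D j ∪ materialInterface Ω (D i) (D j)))
    (G₁ G₂ : EuclideanSpace ℝ (Fin d) → EuclideanSpace ℝ (Fin d))
    (hG₁ : IsGradientUpTo u (D i) (materialInterface Ω (D i) (D j)) G₁)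
    (hG₂ : IsGradientUpTo u (D j) (materialInterface Ω (D i) (D j)) G₂)
    (n₁ n₂ : EuclideanSpace ℝ (Fin d) → EuclideanSpace ℝ (Fin d))
    (hn₁ : ∀ x ∈ materialInterface Ω (D i) (D j), IsOuterUnitNormal (D i) x (n₁ x))
    (hn₂ : ∀ x ∈ materialInterface Ω (D i) (D j), IsOuterUnitNormal (D j) x (n₂ x)) :
    (∀ x ∈ materialInterface Ω (D i) (D j),
      inner ℝ (-(κs i x • G₁ x)) (n₁ x) = -inner ℝ (-(κs j x • G₂ x)) (n₂ x)) ∧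
    (∀ V : Set (EuclideanSpace ℝ (Fin d)), MeasurableSet V → IsCompact (closure V) →
      closure V ⊆ D i ∪ materialInterface Ω (D i) (D j) ∪ D j →
      IntegrableOn (fun x => inner ℝ (-(κs i x • G₁ x)) (n₁ x))
        (materialInterface Ω (D i) (D j) ∩ V) (Measure.euclideanHausdorffMeasure (d - 1)) ∧
      IntegrableOn (fun x => inner ℝ (-(κs j x • G₂ x)) (n₂ x))
        (materialInterface Ω (D i) (D j) ∩ V) (Measure.euclideanHausdorffMeasure (d - 1)) ∧
      (∫ x in materialInterface Ω (D i) (D j) ∩ V,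
          inner ℝ (-(κs i x • G₁ x)) (n₁ x) ∂(Measure.euclideanHausdorffMeasure (d - 1))) +
        (∫ x in materialInterface Ω (D i) (D j) ∩ V,
          inner ℝ (-(κs j x • G₂ x)) (n₂ x) ∂(Measure.euclideanHausdorffMeasure (d - 1))) = 0) := by

  have hneg : ∀ x ∈ materialInterface Ω (D i) (D j), n₂ x = -n₁ x := fun x hx =>
    (hn₁ x hx).neg_of_mem_materialInterface hx (hn₂ x hx)
  have hpt : ∀ x ∈ materialInterface Ω (D i) (D j),
      inner ℝ (-(κs i x • G₁ x)) (n₁ x) = -inner ℝ (-(κs j x • G₂ x)) (n₂ x) := by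
    intro x hx
    have h := hu.inner_normal_eq hD hκ hQ hκi hκj hG₁ hG₂ hx (hn₁ x hx)
      (hneg x hx ▸ hn₂ x hx)
    rw [hneg x hx, inner_neg_left, inner_neg_neg, h]
  have hcn₁ := continuousOn_outerUnitNormal hD.isOpen_domain hn₁
  -- The continuity lemma concerns the normal of the first material; that of the second is its
  -- negative.
  have hcn₂ : ContinuousOn n₂ (materialInterface Ω (D i) (D j)) := hcn₁.neg.congr hneg
  refine ⟨hpt, fun V hV hVc hVs => ?_⟩
  obtain ⟨hm, hI₁⟩ := integrableOn_inner_outerUnitNormal hD.isOpen_domain (hD.isOpen_sub i)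
    (hD.isOpen_sub j) hcn₁ ((hκi.smul hG₁.2).neg.mono subset_union_right) hV hVc hVs
  obtain ⟨-, hI₂⟩ := integrableOn_inner_outerUnitNormal hD.isOpen_domain (hD.isOpen_sub i)
    (hD.isOpen_sub j) hcn₂ ((hκj.smul hG₂.2).neg.mono subset_union_right) hV hVc hVs
  refine ⟨hI₁, hI₂, ?_⟩
  rw [setIntegral_congr_fun hm fun x hx => hpt x hx.1, integral_neg, neg_add_cancel]
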